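/- For $d\ge 0$ let $\mathcal P_d$ be the set of symmetric positive semidefinite matrices in $[-1,1]^{d\times d}$ with unit diagonal, let $\rho$ be Pearson's correlation coefficient, and let $\mathcal P_d^{\mathrm U}$ and $\mathcal P_d^{\mathrm B}(1/2)$ be the sets of correlation matrices $(\rho(Y_i,Y_j))_{i,j=1}^d$ of random vectors $(Y_1,\dots,Y_d)$ whose margins are all $\mathrm U(0,1)$, respectively all $\mathrm{Bern}(1/2)$. For a distribution function $G$ with quantile function $G^{\leftarrow}(p)=\inf\{x\in\mathbb R: G(x)\ge p\}$, $p\in(0,1)$, and random variables $X_1,X_2$ with continuous distribution functions $F_1,F_2$, put $$\kappa_G(X_1,X_2)=\rho\bigl(G^{\leftarrow}(F_1(X_1)),G^{\leftarrow}(F_2(X_2))\bigr).$$ Spearman's rho, Blomqvist's beta and van der Waerden's coefficient are $\kappa_G$ with $G$ the distribution function of $\mathrm U(0,1)$, of $\mathrm{Bern}(1/2)$ and of $\mathrm N(0,1)$, respectively. Let $\mathcal S_d$, $\mathcal B_d$ and $\mathcal W_d$ be the corresponding sets of matrices $(\kappa_G(X_i,X_j))_{i,j=1}^d$, where $(X_1,\dots,X_d)$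 ranges over all random vectors with continuous marginal distribution functions. Then: 1. $\mathcal P_d^{\mathrm U}=\mathcal P_d$ if $d\le 9$, and $\mathcal P_d^{\mathrm U}\subseteq\mathcal P_d$ for every $d$; 2. $\mathcal S_d=\mathcal P_d^{\mathrm U}$; 3. $\mathcal B_d=\mathcal P_d^{\mathrm B}(1/2)$; 4. $\mathcal W_d=\mathcal P_d$. -/

import Mathlib

open MeasureTheory ProbabilityTheory

/-- Pearson's correlation coefficient `ρ(X, Y) = Cov(X, Y) / (√Var(X) √Var(Y))`. -/
noncomputable def pearson {Ω : Type*} [MeasurableSpace Ω] (P : Measure Ω) (X Y : Ω → ℝ) : ℝ :=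
  covariance X Y P / (Real.sqrt (variance X P) * Real.sqrt (variance Y P))

/-- The correlation matrix `ρ(X) = (ρ(X i, X j))` of a random vector. -/
noncomputable def pearsonMatrix {Ω : Type*} [MeasurableSpace Ω] (P : Measure Ω) {d : ℕ}
    (X : Fin d → Ω → ℝ) : Matrix (Fin d) (Fin d) ℝ :=
  Matrix.of fun i j => pearson P (X i) (X j)

/-- The distribution function of the random variable `X` under `P`. -/
noncomputable def distFun {Ω : Type*} [MeasurableSpace Ω] (P : Measure Ω) (X : Ω → ℝ) : ℝ → ℝ :=
  fun x => cdf (P.map X) x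

/-- The quantile function `p ↦ inf {x | G x ≥ p}` of a distribution function `G`. -/
noncomputable def quantile (G : ℝ → ℝ) (p : ℝ) : ℝ :=
  sInf {x : ℝ | p ≤ G x}

/-- The transformed rank correlation coefficient `ρ(G⁻(F_X(X)), G⁻(F_Y(Y)))`, where `G` is the
distribution function of the probability measure `ν`. -/
noncomputable def rankCorr (ν : Measure ℝ) {Ω : Type*} [MeasurableSpace Ω] (P : Measure Ω)
    (X Y : Ω → ℝ) : ℝ :=
  pearson P (fun ω => quantile (cdf ν) (distFun P X (X ω)))
    (fun ω => quantile (cdf ν) (distFun P Y (Y ω)))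

/-- The standard uniform distribution `U(0,1)`. -/
noncomputable def stdUniform : Measure ℝ := volume.restrict (Set.Icc 0 1)

/-- The Bernoulli distribution `Bern(p)` on `ℝ`: mass `p` at `1` and mass `1 - p` at `0`. -/
noncomputable def bern (p : unitInterval) : Measure ℝ := bernoulliMeasure 1 0 p

/-- The parameter `1/2`. -/
noncomputable def half : unitInterval := ⟨1 / 2, by norm_num, by norm_num⟩

/-- The standard normal distribution `N(0,1)`. -/
noncomputable def stdNormal : Measure ℝ := gaussianReal 0 1

/-- Spearman's rho. -/
noncomputable def spearmanRho {Ω : Type*} [MeasurableSpace Ω] (P : Measure Ω)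
    (X Y : Ω → ℝ) : ℝ := rankCorr stdUniform P X Y

/-- Blomqvist's beta. -/
noncomputable def blomqvistBeta {Ω : Type*} [MeasurableSpace Ω] (P : Measure Ω)
    (X Y : Ω → ℝ) : ℝ := rankCorr (bern half) P X Y

/-- Van der Waerden's coefficient. -/
noncomputable def vanDerWaerden {Ω : Type*} [MeasurableSpace Ω] (P : Measure Ω)
    (X Y : Ω → ℝ) : ℝ := rankCorr stdNormal P X Y

/-- `𝒫_d`: symmetric positive semidefinite matrices with entries in `[-1,1]` and unit diagonal. -/
def correlationMatrices (d : ℕ) : Set (Matrix (Fin d) (Fin d) ℝ) :=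
  {R | R.IsSymm ∧ R.PosSemidef ∧ (∀ i j, R i j ∈ Set.Icc (-1 : ℝ) 1) ∧ ∀ i, R i i = 1}

/-- The correlation matrices of `d`-dimensional random vectors all of whose margins have law `ν`.
As only the joint law on `ℝ^d` matters, probability spaces in `Type` suffice. -/
def marginCorrelationMatrices (ν : Measure ℝ) (d : ℕ) : Set (Matrix (Fin d) (Fin d) ℝ) :=
  {R | ∃ (Ω : Type) (_ : MeasurableSpace Ω) (P : Measure Ω) (X : Fin d → Ω → ℝ),
    IsProbabilityMeasure P ∧ (∀ i, Measurable (X i)) ∧ (∀ i, HasLaw (X i) ν P) ∧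
      R = pearsonMatrix P X}

/-- `𝒫_d^U`: correlation matrices of random vectors with `U(0,1)` margins. -/
def uniformCorrelationMatrices (d : ℕ) : Set (Matrix (Fin d) (Fin d) ℝ) :=
  marginCorrelationMatrices stdUniform d

/-- `𝒫_d^B(p)`: correlation matrices of random vectors with `Bern(p)` margins. -/
def bernoulliCorrelationMatrices (p : unitInterval) (d : ℕ) : Set (Matrix (Fin d) (Fin d) ℝ) :=
  marginCorrelationMatrices (bern p) d

/-- The `d × d` matrices `(κ(X i, X j))` of a pairwise coefficient `κ`, over all random vectors
with continuous marginal distribution functions. -/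
def pairwiseMatrices
    (κ : ∀ {Ω : Type} [MeasurableSpace Ω], Measure Ω → (Ω → ℝ) → (Ω → ℝ) → ℝ) (d : ℕ) :
    Set (Matrix (Fin d) (Fin d) ℝ) :=
  {R | ∃ (Ω : Type) (_ : MeasurableSpace Ω) (P : Measure Ω) (X : Fin d → Ω → ℝ),
    IsProbabilityMeasure P ∧ (∀ i, Measurable (X i)) ∧ (∀ i, Continuous (distFun P (X i))) ∧
      R = Matrix.of fun i j => κ P (X i) (X j)}

/-- `𝒮_d`: the Spearman's rho matrices. -/
def spearmanMatrices (d : ℕ) : Set (Matrix (Fin d) (Fin d) ℝ) := pairwiseMatrices spearmanRho d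

/-- `ℬ_d`: the Blomqvist's beta matrices. -/
def blomqvistMatrices (d : ℕ) : Set (Matrix (Fin d) (Fin d) ℝ) := pairwiseMatrices blomqvistBeta d

/-- `𝒲_d`: the van der Waerden's matrices. -/
def vanDerWaerdenMatrices (d : ℕ) : Set (Matrix (Fin d) (Fin d) ℝ) :=
  pairwiseMatrices vanDerWaerden d

/-! Rank coefficients. If `F_i` is continuous, `F_i(X_i)` is uniform, so its image under the
quantile function of `ν` has law `ν`: a rank correlation matrix is a correlation matrix with margins
`ν` (`pairwiseMatrices_rankCorr_subset`). Conversely, for uniform and normal `ν` the quantile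
function inverts the distribution function almost everywhere, so a vector with margins `ν` is its
own rank transform. For Bern(1/2) the atoms are smoothed: with `U` uniform and independent of `Y`,
`(Y_i + U)/2` is uniform and its rank transform returns `Y_i`.

Correlation matrices. Quadratic forms of a correlation matrix are scaled variances, hence
nonnegative; Gaussian vectors realise all of `𝒫_d` with normal margins.

Uniform margins, `d ≤ 9`. By Archimedes, projections of a uniform point of the sphere in `ℝ^3` to
unit vectors `v`, `w` are uniform on `[-1,1]`, and their correlation is `⟨v, w⟩`; so Gram matrices
of unit vectors in `ℝ^3` are attained. The attained set is convex, since mixing joint laws keeps the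
margins. It remains to split a Gram matrix of unit vectors in `ℝ^n`, `n ≥ 4`, into ones of lower
dimension (`gram_mem_of_convex`): symmetric forms on `ℝ^n` have dimension at least `10 > d`, so some
`H ≠ 0` vanishes at all `d` vectors. If `H` has eigenvalues of both signs, replacing the identity by
`1 - cH`, with `1/c` the largest or smallest eigenvalue, keeps the vectors unit and loses a
dimension, and the identity is a convex combination of the two; otherwise the vectors already lie in
a hyperplane. -/

instance isProbabilityMeasure_stdUniform : IsProbabilityMeasure stdUniform :=
  ⟨by simp [stdUniform]⟩

instance isProbabilityMeasure_stdNormal : IsProbabilityMeasure stdNormal := by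
  unfold stdNormal; infer_instance

/-! ### Quantile and probability integral transforms -/

lemma stdUniform_eq_restrict_Ioo : stdUniform = volume.restrict (Set.Ioo 0 1) :=
  Measure.restrict_congr_set Ioo_ae_eq_Icc.symm

lemma ae_stdUniform_mem_Ioo : ∀ᵐ p ∂stdUniform, p ∈ Set.Ioo (0 : ℝ) 1 := by
  rw [stdUniform_eq_restrict_Ioo]
  exact ae_restrict_mem measurableSet_Ioo

lemma cdf_stdUniform (x : ℝ) : cdf stdUniform x = max 0 (min x 1) := by
  rw [cdf_eq_real, stdUniform, measureReal_restrict_apply measurableSet_Iic,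
    show Set.Iic x ∩ Set.Icc 0 1 = Set.Icc 0 (min x 1) by ext y; simp; tauto,
    Real.volume_real_Icc, sub_zero, max_comm]

/-- Right continuity makes the infimum attained; `0 < p < 1` makes the set bounded below and
nonempty. -/
lemma quantile_le_iff (ν : Measure ℝ) {p : ℝ} (hp : p ∈ Set.Ioo (0 : ℝ) 1) (x : ℝ) :
    quantile (cdf ν) p ≤ x ↔ p ≤ cdf ν x := by
  have hbdd : BddBelow {x : ℝ | p ≤ cdf ν x} := by
    obtain ⟨a, ha⟩ := ((tendsto_cdf_atBot ν).eventually_lt_const hp.1).exists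
    exact ⟨a, fun y hy ↦ (monotone_cdf ν).reflect_lt (ha.trans_le hy) |>.le⟩
  have hne : {x : ℝ | p ≤ cdf ν x}.Nonempty := by
    obtain ⟨a, ha⟩ := ((tendsto_cdf_atTop ν).eventually_const_lt hp.2).exists
    exact ⟨a, ha.le⟩
  refine ⟨fun h ↦ ?_, fun h ↦ csInf_le hbdd h⟩
  have hright : Filter.Tendsto (cdf ν) (nhdsWithin x (Set.Ioi x)) (nhds (cdf ν x)) :=
    ((cdf ν).right_continuous x).tendsto.mono_left
      (nhdsWithin_mono x Set.Ioi_subset_Ici_self)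
  refine ge_of_tendsto hright ?_
  filter_upwards [self_mem_nhdsWithin] with y hy
  obtain ⟨z, hz, hzy⟩ := exists_lt_of_csInf_lt hne (h.trans_lt hy)
  exact le_trans hz (monotone_cdf ν hzy.le)

lemma quantile_cdf_of_forall_lt {G : ℝ → ℝ} {x : ℝ} (h : ∀ y < x, G y < G x) :
    quantile G (G x) = x := by
  refine IsLeast.csInf_eq ⟨le_refl (G x), fun y hy ↦ ?_⟩
  by_contra! hlt
  exact absurd hy (not_le.2 (h y hlt))

lemma aemeasurable_quantile (ν : Measure ℝ) : AEMeasurable (quantile (cdf ν)) stdUniform := by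
  rw [stdUniform_eq_restrict_Ioo]
  refine aemeasurable_restrict_of_monotoneOn measurableSet_Ioo fun p hp q hq hpq ↦ ?_
  rw [quantile_le_iff ν hp]
  exact hpq.trans ((quantile_le_iff ν hq _).1 le_rfl)

/-- The quantile function of `ν` transports the uniform distribution to `ν`. -/
lemma hasLaw_quantile (ν : Measure ℝ) [IsProbabilityMeasure ν] :
    HasLaw (quantile (cdf ν)) ν stdUniform where
  aemeasurable := aemeasurable_quantile ν
  map_eq := by
    have := Measure.isProbabilityMeasure_map (aemeasurable_quantile ν)
    refine Measure.eq_of_cdf _ _ ?_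
    ext x
    have hG := cdf_nonneg ν x
    have hG' := cdf_le_one ν x
    rw [cdf_eq_real, map_measureReal_apply_of_aemeasurable (aemeasurable_quantile ν)
      measurableSet_Iic]
    have : stdUniform.real (quantile (cdf ν) ⁻¹' Set.Iic x) = stdUniform.real (Set.Iic (cdf ν x)) :=
      measureReal_congr <| by
        filter_upwards [ae_stdUniform_mem_Ioo] with p hp
        exact propext (quantile_le_iff ν hp x)
    rw [this, ← cdf_eq_real, cdf_stdUniform, min_eq_left hG', max_eq_right hG]

/-- The probability integral transform. -/
lemma hasLaw_cdf {μ : Measure ℝ} [IsProbabilityMeasure μ] (hμ : Continuous (cdf μ)) :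
    HasLaw (cdf μ) stdUniform μ where
  aemeasurable := hμ.aemeasurable
  map_eq := by
    have := Measure.isProbabilityMeasure_map (μ := μ) hμ.aemeasurable
    have hsurj {x : ℝ} (hx : x ∈ Set.Ioo (0 : ℝ) 1) : ∃ b, cdf μ b = x :=
      mem_range_of_exists_le_of_exists_ge hμ
        ((tendsto_cdf_atBot μ).eventually_le_const hx.1).exists
        ((tendsto_cdf_atTop μ).eventually_const_le hx.2).exists
    refine Measure.eq_of_cdf _ _ ?_
    ext x
    rw [cdf_eq_real, map_measureReal_apply hμ.measurable measurableSet_Iic, cdf_stdUniform]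
    refine le_antisymm ?_ ?_
    · rcases lt_or_ge x 0 with hx | hx
      · rw [show cdf μ ⁻¹' Set.Iic x = ∅ from Set.eq_empty_of_forall_notMem fun y hy ↦
          absurd (cdf_nonneg μ y) (not_le.2 (lt_of_le_of_lt hy hx))]
        simp
      rcases le_or_gt 1 x with hx1 | hx1
      · simp [hx1]
      rw [min_eq_left hx1.le, max_eq_right hx]
      -- The distribution function `F` may have flat pieces, so compare with `y = F b` above `x`: `F
      -- z ≤ x < F b` forces `z < b`.
      refine le_of_forall_gt_imp_ge_of_dense fun y hy ↦ ?_
      rcases le_or_gt 1 y with hy1 | hy1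
      · exact measureReal_le_one.trans hy1
      obtain ⟨b, rfl⟩ := hsurj ⟨hx.trans_lt hy, hy1⟩
      rw [cdf_eq_real μ b]
      exact measureReal_mono fun z hz ↦
        ((monotone_cdf μ).reflect_lt (lt_of_le_of_lt hz hy)).le
    · rcases le_or_gt x 0 with hx | hx
      · simp [hx.trans zero_le_one, hx]
      rcases le_or_gt 1 x with hx1 | hx1
      · rw [show cdf μ ⁻¹' Set.Iic x = Set.univ from
          Set.eq_univ_of_forall fun y ↦ (cdf_le_one μ y).trans hx1]
        simp [hx1]
      rw [min_eq_left hx1.le, max_eq_right hx.le]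
      obtain ⟨b, rfl⟩ := hsurj ⟨hx, hx1⟩
      rw [cdf_eq_real μ b]
      exact measureReal_mono fun z hz ↦ by simpa [← cdf_eq_real] using monotone_cdf μ hz

/-! ### Rank correlations versus correlations with fixed margins -/

lemma pearson_congr {Ω : Type*} [MeasurableSpace Ω] {P : Measure Ω} {X X' Y Y' : Ω → ℝ}
    (hX : X =ᵐ[P] X') (hY : Y =ᵐ[P] Y') : pearson P X Y = pearson P X' Y' := by
  have hcov : covariance X Y P = covariance X' Y' P := by
    simp only [covariance, integral_congr_ae hX, integral_congr_ae hY]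
    refine integral_congr_ae ?_
    filter_upwards [hX, hY] with ω h1 h2
    rw [h1, h2]
  rw [pearson, pearson, hcov, variance_congr hX, variance_congr hY]

lemma rankCorr_eq_pearson {ν : Measure ℝ} {Ω : Type*} [MeasurableSpace Ω] {P : Measure Ω}
    {X Y X' Y' : Ω → ℝ} (hX : (fun ω ↦ quantile (cdf ν) (distFun P X (X ω))) =ᵐ[P] X')
    (hY : (fun ω ↦ quantile (cdf ν) (distFun P Y (Y ω))) =ᵐ[P] Y') :
    rankCorr ν P X Y = pearson P X' Y' :=
  pearson_congr hX hY

lemma distFun_eq_of_hasLaw {Ω : Type*} [MeasurableSpace Ω] {P : Measure Ω} {X : Ω → ℝ}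
    {μ : Measure ℝ} (h : HasLaw X μ P) : distFun P X = cdf μ := by
  ext x; rw [distFun, h.map_eq]

lemma hasLaw_distFun {Ω : Type*} [MeasurableSpace Ω] {P : Measure Ω} [IsProbabilityMeasure P]
    {X : Ω → ℝ} (hX : Measurable X) (hc : Continuous (distFun P X)) :
    HasLaw (fun ω ↦ distFun P X (X ω)) stdUniform P := by
  have := Measure.isProbabilityMeasure_map (μ := P) hX.aemeasurable
  exact (hasLaw_cdf hc).comp ⟨hX.aemeasurable, rfl⟩

lemma pairwiseMatrices_rankCorr_subset (ν : Measure ℝ) [IsProbabilityMeasure ν] (d : ℕ) :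
    pairwiseMatrices (fun P X Y ↦ rankCorr ν P X Y) d ⊆ marginCorrelationMatrices ν d := by
  rintro R ⟨Ω, _, P, X, hP, hX, hc, rfl⟩
  -- Monotonicity gives measurability of the quantile function only on `(0,1)`; a measurable version
  -- `g` yields a genuine random vector with the same correlations.
  obtain ⟨g, hg, hgq⟩ := aemeasurable_quantile ν
  have hlaw (i) := hasLaw_distFun (hX i) (hc i)
  have hae (i) : (fun ω ↦ quantile (cdf ν) (distFun P (X i) (X i ω))) =ᵐ[P]
      fun ω ↦ g (distFun P (X i) (X i ω)) := by
    refine ae_of_ae_map (hlaw i).aemeasurable (p := fun p ↦ quantile (cdf ν) p = g p) ?_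
    rw [(hlaw i).map_eq]
    exact hgq
  refine ⟨Ω, _, P, fun i ω ↦ g (distFun P (X i) (X i ω)), hP,
    fun i ↦ hg.comp ((hc i).measurable.comp (hX i)), fun i ↦ ?_, ?_⟩
  · exact ((hasLaw_quantile ν).congr hgq.symm).comp (hlaw i)
  · ext i j
    exact rankCorr_eq_pearson (hae i) (hae j)

lemma marginCorrelationMatrices_subset_pairwiseMatrices {ν : Measure ℝ} {d : ℕ}
    (hc : Continuous (cdf ν)) (hq : ∀ᵐ x ∂ν, quantile (cdf ν) (cdf ν x) = x) :
    marginCorrelationMatrices ν d ⊆ pairwiseMatrices (fun P X Y ↦ rankCorr ν P X Y) d := by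
  rintro R ⟨Ω, _, P, X, hP, hX, hlaw, rfl⟩
  have hF (i) := distFun_eq_of_hasLaw (hlaw i)
  have hae (i) : (fun ω ↦ quantile (cdf ν) (distFun P (X i) (X i ω))) =ᵐ[P] X i := by
    rw [hF i]
    refine ae_of_ae_map (hlaw i).aemeasurable (p := fun x ↦ quantile (cdf ν) (cdf ν x) = x) ?_
    rwa [(hlaw i).map_eq]
  refine ⟨Ω, _, P, X, hP, hX, fun i ↦ by rwa [hF i], ?_⟩
  ext i j
  exact (rankCorr_eq_pearson (hae i) (hae j)).symm

lemma continuous_cdf_stdUniform : Continuous (cdf stdUniform) := by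
  rw [show ⇑(cdf stdUniform) = fun x ↦ max 0 (min x 1) from funext cdf_stdUniform]
  fun_prop

lemma ae_quantile_cdf_stdUniform :
    ∀ᵐ x ∂stdUniform, quantile (cdf stdUniform) (cdf stdUniform x) = x := by
  filter_upwards [ae_stdUniform_mem_Ioo] with x hx
  refine quantile_cdf_of_forall_lt fun y hy ↦ ?_
  rw [cdf_stdUniform, cdf_stdUniform, min_eq_left hx.2.le, max_eq_right hx.1.le]
  exact max_lt hx.1 (min_lt_of_left_lt hy)

/-- The jump of the distribution function at `x` is the mass of `{x}`. -/
lemma continuous_cdf_of_nullSingletonClass (μ : Measure ℝ) [IsProbabilityMeasure μ] [NullSingletonClass μ] :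
    Continuous (cdf μ) := by
  refine continuous_iff_continuousAt.2 fun x ↦ ?_
  rw [(monotone_cdf μ).continuousAt_iff_leftLim_eq_rightLim, (cdf μ).rightLim_eq]
  have h : (cdf μ).measure {x} = 0 := by rw [measure_cdf]; exact measure_singleton x
  rw [StieltjesFunction.measure_singleton, ENNReal.ofReal_eq_zero] at h
  exact le_antisymm ((monotone_cdf μ).leftLim_le le_rfl) (by linarith)

lemma strictMono_cdf_of_isOpenPosMeasure (μ : Measure ℝ) [IsProbabilityMeasure μ]
    [μ.IsOpenPosMeasure] : StrictMono (cdf μ) := by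
  intro x y hxy
  have h : 0 < μ (Set.Ioo x y) := (Measure.measure_Ioo_pos μ).2 hxy
  have h2 : μ (Set.Ioo x y) ≤ (cdf μ).measure (Set.Ioc x y) := by
    rw [measure_cdf]; exact measure_mono Set.Ioo_subset_Ioc_self
  rw [StieltjesFunction.measure_Ioc] at h2
  have := ENNReal.ofReal_pos.1 (h.trans_le h2)
  linarith

instance nullSingletonClass_stdNormal : NullSingletonClass stdNormal :=
  nullSingletonClass_gaussianReal one_ne_zero

instance isOpenPosMeasure_stdNormal : stdNormal.IsOpenPosMeasure :=
  (gaussianReal_absolutelyContinuous' 0 one_ne_zero).isOpenPosMeasure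

lemma quantile_cdf_stdNormal (x : ℝ) : quantile (cdf stdNormal) (cdf stdNormal x) = x :=
  quantile_cdf_of_forall_lt fun _ hy ↦ strictMono_cdf_of_isOpenPosMeasure stdNormal hy

theorem spearmanMatrices_eq (d : ℕ) : spearmanMatrices d = uniformCorrelationMatrices d :=
  (pairwiseMatrices_rankCorr_subset stdUniform d).antisymm
    (marginCorrelationMatrices_subset_pairwiseMatrices continuous_cdf_stdUniform
      ae_quantile_cdf_stdUniform)

theorem vanDerWaerdenMatrices_eq (d : ℕ) :
    vanDerWaerdenMatrices d = marginCorrelationMatrices stdNormal d :=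
  (pairwiseMatrices_rankCorr_subset stdNormal d).antisymm
    (marginCorrelationMatrices_subset_pairwiseMatrices (continuous_cdf_of_nullSingletonClass _)
      (.of_forall quantile_cdf_stdNormal))

/-! ### Positive semidefiniteness, and realisation by Gaussian vectors -/

/-- Both `X + Y` and `X - Y` have nonnegative variance. -/
lemma abs_covariance_le_of_variance_eq {Ω : Type*} [MeasurableSpace Ω] {P : Measure Ω}
    [IsProbabilityMeasure P] {X Y : Ω → ℝ} {V : ℝ} (hX : MemLp X 2 P) (hY : MemLp Y 2 P)
    (hVX : variance X P = V) (hVY : variance Y P = V) : |covariance X Y P| ≤ V := by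
  have h1 := variance_add hX hY
  have h2 := variance_sub hX hY
  have h3 := variance_nonneg (X + Y) P
  have h4 := variance_nonneg (X - Y) P
  rw [abs_le]
  constructor <;> linarith

lemma pearson_eq_div {Ω : Type*} [MeasurableSpace Ω] {P : Measure Ω} {X Y : Ω → ℝ} {V : ℝ}
    (hVX : variance X P = V) (hVY : variance Y P = V) :
    pearson P X Y = covariance X Y P / V := by
  have hV : 0 ≤ V := hVX ▸ variance_nonneg X P
  rw [pearson, hVX, hVY, Real.mul_self_sqrt hV]

/-- The quadratic form at `x` is the variance of `∑ x_i X_i` divided by the common variance. For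
degenerate `ν` the diagonal would be `0 / 0 = 0`. -/
theorem marginCorrelationMatrices_subset_correlationMatrices {ν : Measure ℝ} (d : ℕ)
    (hν : MemLp id 2 ν) (hvar : variance id ν ≠ 0) :
    marginCorrelationMatrices ν d ⊆ correlationMatrices d := by
  rintro R ⟨Ω, _, P, X, hP, hX, hlaw, rfl⟩
  set V := variance id ν
  have hVpos : 0 < V := lt_of_le_of_ne (variance_nonneg _ _) hvar.symm
  have hV (i) : variance (X i) P = V := (hlaw i).variance_eq
  have hmem (i) : MemLp (X i) 2 P := by
    have h := (hlaw i).map_eq ▸ hν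
    exact (memLp_map_measure_iff h.aestronglyMeasurable (hX i).aemeasurable).1 h
  have hR (i j) : pearsonMatrix P X i j = covariance (X i) (X j) P / V :=
    pearson_eq_div (hV i) (hV j)
  have hdiag (i) : pearsonMatrix P X i i = 1 := by
    rw [hR, covariance_self (hX i).aemeasurable, hV, div_self hVpos.ne']
  have hsymm : (pearsonMatrix P X).IsSymm := by
    ext i j
    rw [Matrix.transpose_apply, hR, hR, covariance_comm]
  refine ⟨hsymm, .of_dotProduct_mulVec_nonneg ?_ fun x ↦ ?_, fun i j ↦ ?_, hdiag⟩
  · rwa [Matrix.IsHermitian, Matrix.conjTranspose_eq_transpose_of_trivial]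
  · have h : star x ⬝ᵥ (pearsonMatrix P X).mulVec x
        = covariance (fun ω ↦ ∑ i, x i * X i ω) (fun ω ↦ ∑ i, x i * X i ω) P / V := by
      rw [covariance_fun_sum_fun_sum (fun i ↦ (hmem i).const_mul _) fun i ↦ (hmem i).const_mul _]
      simp only [dotProduct, Matrix.mulVec, hR, Pi.star_apply, star_trivial,
        covariance_const_mul_left, covariance_const_mul_right, Finset.mul_sum, Finset.sum_div]
      exact Finset.sum_congr rfl fun i _ ↦ Finset.sum_congr rfl fun j _ ↦ by ring
    rw [h, covariance_self (by fun_prop)]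
    exact div_nonneg (variance_nonneg _ _) hVpos.le
  · rw [hR, Set.mem_Icc, ← abs_le, abs_div, abs_of_pos hVpos, div_le_one hVpos]
    exact abs_covariance_le_of_variance_eq (hmem i) (hmem j) (hV i) (hV j)

lemma memLp_id_stdUniform : MemLp id 2 stdUniform :=
  MemLp.of_bound aestronglyMeasurable_id 1 <| by
    filter_upwards [ae_stdUniform_mem_Ioo] with x hx
    rw [id, Real.norm_eq_abs, abs_le]
    constructor <;> linarith [hx.1, hx.2]

lemma integral_stdUniform (f : ℝ → ℝ) : ∫ x, f x ∂stdUniform = ∫ x in (0 : ℝ)..1, f x := by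
  rw [intervalIntegral.integral_of_le zero_le_one, stdUniform, integral_Icc_eq_integral_Ioc]

lemma integral_id_stdUniform : ∫ x, x ∂stdUniform = 1 / 2 := by
  rw [integral_stdUniform]; norm_num

lemma variance_id_stdUniform : variance id stdUniform = 1 / 12 := by
  rw [variance_eq_sub memLp_id_stdUniform]
  simp only [Pi.pow_apply, id]
  rw [integral_id_stdUniform, integral_stdUniform, integral_pow]
  norm_num

theorem uniformCorrelationMatrices_subset (d : ℕ) :
    uniformCorrelationMatrices d ⊆ correlationMatrices d :=
  marginCorrelationMatrices_subset_correlationMatrices d memLp_id_stdUniform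
    (by rw [variance_id_stdUniform]; norm_num)

lemma variance_id_stdNormal : variance id stdNormal = 1 := by
  simp [stdNormal, variance_id_gaussianReal]

theorem marginCorrelationMatrices_stdNormal (d : ℕ) :
    marginCorrelationMatrices stdNormal d = correlationMatrices d := by
  refine (marginCorrelationMatrices_subset_correlationMatrices (ν := stdNormal) d
    (memLp_id_gaussianReal 2)
    (by rw [variance_id_stdNormal]; exact one_ne_zero)).antisymm ?_
  rintro R ⟨-, hR, -, hdiag⟩
  have hlaw (i : Fin d) : HasLaw (fun x : EuclideanSpace ℝ (Fin d) ↦ x i) stdNormal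
      (multivariateGaussian 0 R) := by
    have h := (measurePreserving_eval_multivariateGaussian (μ := 0) hR (i := i)).hasLaw
    simpa [hdiag, stdNormal] using h
  refine ⟨EuclideanSpace ℝ (Fin d), _, multivariateGaussian 0 R, fun i x ↦ x i, inferInstance,
    fun i ↦ by fun_prop, hlaw, ?_⟩
  ext i j
  have hV (i) := (hlaw i).variance_eq.trans variance_id_stdNormal
  rw [pearsonMatrix, Matrix.of_apply, pearson_eq_div (hV i) (hV j),
    covariance_eval_multivariateGaussian hR, div_one]

/-! ### Blomqvist's beta -/

lemma bern_half_eq :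
    bern half = (2⁻¹ : NNReal) • Measure.dirac 1 + (2⁻¹ : NNReal) • Measure.dirac 0 := by
  have h1 : unitInterval.toNNReal half = 2⁻¹ := by
    ext; simp [half]
  have h2 : unitInterval.toNNReal (unitInterval.symm half) = 2⁻¹ := by
    ext; norm_num [half]
  rw [bern, bernoulliMeasure_def, h1, h2]

lemma bern_half_apply {s : Set ℝ} (hs : MeasurableSet s) :
    bern half s = 2⁻¹ * s.indicator 1 1 + 2⁻¹ * s.indicator 1 0 := by
  simp [bern_half_eq, hs, ENNReal.smul_def]

instance isProbabilityMeasure_bern_half : IsProbabilityMeasure (bern half) :=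
  ⟨by simp [bern_half_apply, ENNReal.inv_two_add_inv_two]⟩

lemma cdf_bern_half (x : ℝ) :
    cdf (bern half) x = if x < 0 then 0 else if x < 1 then 1 / 2 else 1 := by
  rw [cdf_eq_real, measureReal_def, bern_half_apply measurableSet_Iic]
  split_ifs with h0 h1
  · simp [h0, h0.trans zero_lt_one]
  · simp [h1, not_lt.1 h0]
  · simp [not_lt.1 h0, not_lt.1 h1, ENNReal.inv_two_add_inv_two]

lemma quantile_bern_half {p : ℝ} (hp : p ∈ Set.Ioo (0 : ℝ) 1) :
    quantile (cdf (bern half)) p = if p ≤ 1 / 2 then 0 else 1 := by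
  refine eq_of_forall_ge_iff fun x ↦ ?_
  rw [quantile_le_iff _ hp, cdf_bern_half]
  obtain ⟨h0, h1⟩ := hp
  split_ifs <;> constructor <;> intro _ <;> linarith

lemma stdUniform_Iic (x : ℝ) : stdUniform (Set.Iic x) = ENNReal.ofReal (max 0 (min x 1)) := by
  rw [← ofReal_cdf, cdf_stdUniform]

/-- Prefixing a fair binary digit to a uniform number gives a uniform number. -/
lemma hasLaw_bern_half_add_stdUniform :
    HasLaw (fun p : ℝ × ℝ ↦ (p.1 + p.2) / 2) stdUniform ((bern half).prod stdUniform) where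
  map_eq := by
    have hm : Measurable fun p : ℝ × ℝ ↦ (p.1 + p.2) / 2 := by fun_prop
    have := Measure.isProbabilityMeasure_map (μ := (bern half).prod stdUniform) hm.aemeasurable
    refine Measure.ext_of_Iic _ _ fun x ↦ ?_
    rw [Measure.map_apply hm measurableSet_Iic, Measure.prod_apply (hm measurableSet_Iic)]
    have hs (y : ℝ) : Prod.mk y ⁻¹' ((fun p : ℝ × ℝ ↦ (p.1 + p.2) / 2) ⁻¹' Set.Iic x)
        = Set.Iic (2 * x - y) := by
      ext v
      simp only [Set.mem_preimage, Set.mem_Iic]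
      constructor <;> intro h <;> linarith
    simp only [hs, stdUniform_Iic]
    rw [bern_half_eq, lintegral_add_measure, lintegral_smul_measure,
      lintegral_smul_measure, lintegral_dirac, lintegral_dirac, ENNReal.smul_def,
      ENNReal.smul_def, smul_eq_mul, smul_eq_mul,
      show ((2⁻¹ : NNReal) : ENNReal) = ENNReal.ofReal (1 / 2) by simp [ENNReal.ofReal_inv_of_pos],
      ← ENNReal.ofReal_mul (by norm_num), ← ENNReal.ofReal_mul (by norm_num),
      ← ENNReal.ofReal_add (by positivity) (by positivity)]
    congr 1
    -- Clamping to `[0,1]` satisfies: the mean of the clamps of `2x - 1` and `2x` is the clamp of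
    -- `x`.
    simp only [max_def, min_def]
    split_ifs <;> linarith

lemma ae_bern_half : ∀ᵐ y ∂(bern half), y = 0 ∨ y = 1 := by
  rw [ae_iff, bern_half_apply (by measurability)]
  simp

theorem bernoulliCorrelationMatrices_half_subset (d : ℕ) :
    bernoulliCorrelationMatrices half d ⊆ blomqvistMatrices d := by
  rintro R ⟨Ω, _, P, Y, hP, hY, hlaw, rfl⟩
  let X : Fin d → Ω × ℝ → ℝ := fun i p ↦ (Y i p.1 + p.2) / 2
  have hX (i) : HasLaw (X i) stdUniform (P.prod stdUniform) := by
    refine hasLaw_bern_half_add_stdUniform.comp (X := fun p : Ω × ℝ ↦ (Y i p.1, p.2))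
      ⟨by fun_prop, ?_⟩
    have := Measure.map_prod_map P stdUniform (hY i) measurable_id
    rw [(hlaw i).map_eq, Measure.map_id] at this
    exact this.symm
  have hF (i) := distFun_eq_of_hasLaw (hX i)
  -- The endpoint matters: `Y = 1`, `U = 0` gives `1/2`, which the quantile function sends to `0`.
  have hU : ∀ᵐ p ∂(P.prod stdUniform), p.2 ∈ Set.Ioo (0 : ℝ) 1 :=
    Measure.quasiMeasurePreserving_snd.ae ae_stdUniform_mem_Ioo
  have hB (i) : ∀ᵐ p ∂(P.prod stdUniform), Y i p.1 = 0 ∨ Y i p.1 = 1 :=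
    Measure.quasiMeasurePreserving_fst.ae <| ae_of_ae_map (hlaw i).aemeasurable
      (p := fun y ↦ y = 0 ∨ y = 1) (by rw [(hlaw i).map_eq]; exact ae_bern_half)
  have hae (i) : (fun p ↦ quantile (cdf (bern half)) (distFun (P.prod stdUniform) (X i) (X i p)))
      =ᵐ[P.prod stdUniform] fun p ↦ Y i p.1 := by
    filter_upwards [hU, hB i] with p ⟨h0, h1⟩ hp
    have hXp : X i p ∈ Set.Ioo (0 : ℝ) 1 := by
      rcases hp with hp | hp <;> simp only [X, hp] <;> constructor <;> linarith
    rw [hF, cdf_stdUniform, min_eq_left hXp.2.le, max_eq_right hXp.1.le, quantile_bern_half hXp]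
    rcases hp with hp | hp <;> simp only [X, hp]
    · exact if_pos (by linarith)
    · exact if_neg (by linarith)
  refine ⟨Ω × ℝ, _, P.prod stdUniform, X, inferInstance, fun i ↦ by fun_prop,
    fun i ↦ by rw [hF]; exact continuous_cdf_stdUniform, ?_⟩
  have hfst : (P.prod stdUniform).map Prod.fst = P := by simp
  ext i j
  refine Eq.trans ?_ (rankCorr_eq_pearson (hae i) (hae j)).symm
  have hvar (i) : variance (fun p ↦ Y i p.1) (P.prod stdUniform) = variance (Y i) P := by
    conv_rhs => rw [← hfst, variance_map (hY i).aemeasurable measurable_fst.aemeasurable]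
    rfl
  have hcov : covariance (fun p ↦ Y i p.1) (fun p ↦ Y j p.1) (P.prod stdUniform)
      = covariance (Y i) (Y j) P := by
    conv_rhs => rw [← hfst, covariance_map (hY i).aestronglyMeasurable
      (hY j).aestronglyMeasurable measurable_fst.aemeasurable]
    rfl
  rw [pearsonMatrix, Matrix.of_apply, pearson, pearson, hvar, hvar, hcov]

theorem blomqvistMatrices_eq (d : ℕ) :
    blomqvistMatrices d = bernoulliCorrelationMatrices half d :=
  (pairwiseMatrices_rankCorr_subset (bern half) d).antisymm
    (bernoulliCorrelationMatrices_half_subset d)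

/-! ### Lowering the dimension of Gram matrices by convexity -/

open Matrix in
/-- A dimension count: if `d < m (m + 1) / 2`, some nonzero quadratic form on `ℝ^m` vanishes at
`d` given vectors. -/
lemma exists_isSymm_diag_eq_zero {ι κ : Type*} [Fintype ι] [DecidableEq ι] [Fintype κ]
    (W : Matrix ι κ ℝ) (h : Fintype.card κ < Fintype.card (Sym2 ι)) :
    ∃ H : Matrix ι ι ℝ, H.IsSymm ∧ H ≠ 0 ∧ ∀ k, (Wᵀ * H * W) k k = 0 := by
  -- Functions on unordered pairs parametrise symmetric matrices; `L` evaluates the form at the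
  -- columns of `W`.
  let S : (Sym2 ι → ℝ) →ₗ[ℝ] Matrix ι ι ℝ :=
    { toFun := fun c ↦ Matrix.of fun i j ↦ c s(i, j)
      map_add' := fun _ _ ↦ rfl
      map_smul' := fun _ _ ↦ rfl }
  let L : (Sym2 ι → ℝ) →ₗ[ℝ] (κ → ℝ) :=
    { toFun := fun c k ↦ (Wᵀ * S c * W) k k
      map_add' := fun c c' ↦ by ext k; simp [Matrix.mul_add, Matrix.add_mul]
      map_smul' := fun a c ↦ by ext k; simp }
  have hker : LinearMap.ker L ≠ ⊥ := LinearMap.ker_ne_bot_of_finrank_lt (by simpa using h)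
  obtain ⟨c, hc, hc0⟩ := Submodule.exists_mem_ne_zero_of_ne_bot hker
  refine ⟨S c, ?_, fun h0 ↦ hc0 ?_, fun k ↦ congrFun (LinearMap.mem_ker.1 hc) k⟩
  · ext i j
    exact congrArg c Sym2.eq_swap
  · ext s
    induction s with
    | _ i j => exact congrFun (congrFun h0 i) j

open Matrix in
-- Rotating the columns into an eigenbasis of the form keeps their Gram matrix and makes the form
-- diagonal.
lemma exists_gram_eq_diagonal {ι κ : Type*} [Fintype ι] [DecidableEq ι] [Fintype κ]
    (W : Matrix ι κ ℝ) (h : Fintype.card κ < Fintype.card (Sym2 ι)) :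
    ∃ (V : Matrix ι κ ℝ) (l : ι → ℝ), l ≠ 0 ∧ Vᵀ * V = Wᵀ * W ∧
      ∀ k, (Vᵀ * diagonal l * V) k k = 0 := by
  obtain ⟨H, hs, h0, hk⟩ := exists_isSymm_diag_eq_zero W h
  have hH : H.IsHermitian := by rwa [IsHermitian, conjTranspose_eq_transpose_of_trivial]
  have hU : (hH.eigenvectorUnitary : Matrix ι ι ℝ) *
      (hH.eigenvectorUnitary : Matrix ι ι ℝ)ᵀ = 1 := by
    have := Unitary.coe_mul_star_self hH.eigenvectorUnitary
    rwa [Unitary.coe_star, star_eq_conjTranspose, conjTranspose_eq_transpose_of_trivial] at this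
  refine ⟨(hH.eigenvectorUnitary : Matrix ι ι ℝ)ᵀ * W, hH.eigenvalues,
    fun h ↦ h0 (hH.eigenvalues_eq_zero_iff.1 h), ?_, fun k ↦ ?_⟩
  · rw [transpose_mul, transpose_transpose, Matrix.mul_assoc, ← Matrix.mul_assoc _ _ W, hU,
      Matrix.one_mul]
  · rw [← hk k]
    have hsp := hH.spectral_theorem
    rw [Unitary.conjStarAlgAut_apply, star_eq_conjTranspose,
      conjTranspose_eq_transpose_of_trivial] at hsp
    conv_rhs => rw [hsp]
    simp only [transpose_mul, transpose_transpose, Matrix.mul_assoc]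
    rfl

open Matrix in
lemma gram_eq_of_row_eq_zero {m : ℕ} {κ : Type*} (V : Matrix (Fin (m + 1)) κ ℝ)
    (i₀ : Fin (m + 1)) (h : ∀ k, V i₀ k = 0) :
    Vᵀ * V = (V.submatrix i₀.succAbove id)ᵀ * V.submatrix i₀.succAbove id := by
  ext k l
  simp [mul_apply, Fin.sum_univ_succAbove _ i₀, h]

open Matrix in
/-- Gram matrices of `d` unit vectors are convex combinations of Gram matrices of unit vectors in
`ℝ^r`, as soon as `d < (r + 1) (r + 2) / 2`. -/
theorem gram_mem_of_convex {κ : Type*} [Fintype κ] {S : Set (Matrix κ κ ℝ)} (hS : Convex ℝ S)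
    {r : ℕ} (hr : Fintype.card κ < (r + 2).choose 2)
    (hbase : ∀ W : Matrix (Fin r) κ ℝ, (∀ k, (Wᵀ * W) k k = 1) → Wᵀ * W ∈ S) (n : ℕ) :
    ∀ W : Matrix (Fin (r + n)) κ ℝ, (∀ k, (Wᵀ * W) k k = 1) → Wᵀ * W ∈ S := by
  induction n with
  | zero => exact hbase
  | succ n ih =>
    intro W hW
    have hdrop (V : Matrix (Fin (r + n + 1)) κ ℝ) (i₀) (h0 : ∀ k, V i₀ k = 0)
        (hV : ∀ k, (Vᵀ * V) k k = 1) : Vᵀ * V ∈ S := by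
      rw [gram_eq_of_row_eq_zero V i₀ h0] at hV ⊢
      exact ih _ hV
    obtain ⟨V, l, hl, hVW, hV0⟩ := exists_gram_eq_diagonal (ι := Fin (r + n + 1)) W <| by
      rw [Sym2.card, Fintype.card_fin]
      exact hr.trans_le (Nat.choose_le_choose 2 (by omega))
    rw [← hVW] at hW ⊢
    have hsum (k) : ∑ i, l i * V i k ^ 2 = 0 := by
      rw [← hV0 k, Matrix.mul_assoc, mul_apply]
      exact Finset.sum_congr rfl fun i _ ↦ by
        rw [diagonal_mul, transpose_apply]; ring
    obtain ⟨i₁, hi₁⟩ := Finite.exists_max l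
    obtain ⟨i₂, hi₂⟩ := Finite.exists_min l
    obtain ⟨j, hj⟩ := Function.ne_iff.1 hl
    -- If all eigenvalues have one sign, every term of the vanishing sum is zero, so a coordinate
    -- with `l j ≠ 0` vanishes on all vectors.
    have hzero (h : ∀ k, ∀ i, l i * V i k ^ 2 = 0) : Vᵀ * V ∈ S :=
      hdrop V j (fun k ↦ by simpa [show l j ≠ 0 from hj] using h k j) hW
    rcases le_or_gt 0 (l i₂) with h2 | h2
    · refine hzero fun k i ↦ ?_
      exact (Finset.sum_eq_zero_iff_of_nonneg fun i _ ↦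
        mul_nonneg (h2.trans (hi₂ i)) (sq_nonneg _)).1 (hsum k) i (Finset.mem_univ i)
    rcases le_or_gt (l i₁) 0 with h1 | h1
    · refine hzero fun k i ↦ ?_
      exact (Finset.sum_eq_zero_iff_of_nonpos fun i _ ↦
        mul_nonpos_of_nonpos_of_nonneg ((hi₁ i).trans h1) (sq_nonneg _)).1 (hsum k) i
        (Finset.mem_univ i)
    -- Scaling coordinate `i` by `√(1 - c * l i)` preserves norms, by `hsum`, and kills coordinate
    -- `i₀`.
    have key (c : ℝ) (i₀) (h0 : c * l i₀ = 1) (hc : ∀ i, c * l i ≤ 1) :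
        (Matrix.of fun k k' ↦ ∑ i, (1 - c * l i) * (V i k * V i k')) ∈ S := by
      let V' : Matrix (Fin (r + n + 1)) κ ℝ := Matrix.of fun i k ↦ √(1 - c * l i) * V i k
      have hV' : V'ᵀ * V' = Matrix.of fun k k' ↦ ∑ i, (1 - c * l i) * (V i k * V i k') := by
        ext k k'
        simp only [mul_apply, transpose_apply, V', Matrix.of_apply]
        refine Finset.sum_congr rfl fun i _ ↦ ?_
        linear_combination (V i k * V i k') * Real.mul_self_sqrt (sub_nonneg.2 (hc i))
      rw [← hV']
      refine hdrop V' i₀ (fun k ↦ by simp [V', h0]) fun k ↦ ?_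
      have hWk : ∑ i, V i k * V i k = 1 := by simpa [mul_apply] using hW k
      calc (V'ᵀ * V') k k = ∑ i, (V i k * V i k - c * (l i * V i k ^ 2)) := by
            rw [hV', Matrix.of_apply]
            exact Finset.sum_congr rfl fun i _ ↦ by ring
        _ = 1 := by rw [Finset.sum_sub_distrib, ← Finset.mul_sum, hsum, hWk, mul_zero, sub_zero]
    have hmem₁ := key (l i₁)⁻¹ i₁ (inv_mul_cancel₀ h1.ne') fun i ↦ by
      rw [inv_mul_le_iff₀ h1]; simpa using hi₁ i
    have hmem₂ := key (l i₂)⁻¹ i₂ (inv_mul_cancel₀ h2.ne) fun i ↦ by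
      rw [← div_eq_inv_mul, div_le_one_of_neg h2]; exact hi₂ i
    have hpos : 0 < l i₁ - l i₂ := by linarith
    -- The weights solve `a + b = 1` and `a / l i₁ + b / l i₂ = 0`, so the perturbations cancel.
    have hconv := hS hmem₁ hmem₂ (a := l i₁ / (l i₁ - l i₂)) (b := -l i₂ / (l i₁ - l i₂))
      (by positivity) (div_nonneg (by linarith) hpos.le)
      (by rw [← add_div, ← sub_eq_add_neg, div_self hpos.ne'])
    convert! hconv using 1
    ext k k'
    simp only [mul_apply, transpose_apply, Matrix.add_apply, Matrix.smul_apply, Matrix.of_apply, smul_eq_mul,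
      Finset.mul_sum, ← Finset.sum_add_distrib]
    refine Finset.sum_congr rfl fun i _ ↦ ?_
    have := h1.ne'
    have := h2.ne
    have := hpos.ne'
    field_simp
    ring

open Matrix in
open scoped MatrixOrder in
lemma exists_gram_of_mem_correlationMatrices {d : ℕ} (r : ℕ) {R : Matrix (Fin d) (Fin d) ℝ}
    (hR : R ∈ correlationMatrices d) :
    ∃ W : Matrix (Fin (r + d)) (Fin d) ℝ, Wᵀ * W = R ∧ ∀ k, (Wᵀ * W) k k = 1 := by
  obtain ⟨-, hpos, -, hdiag⟩ := hR
  obtain ⟨B, hB⟩ := CStarAlgebra.nonneg_iff_eq_star_mul_self.1 hpos.nonneg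
  -- Padding a square factor with `r` zero rows puts it in dimension `r + d`, from which the descent
  -- to `r` starts.
  have h : (Matrix.of (Fin.append (0 : Fin r → Fin d → ℝ) fun i ↦ B i))ᵀ *
      Matrix.of (Fin.append (0 : Fin r → Fin d → ℝ) fun i ↦ B i) = R := by
    rw [hB]
    ext k l
    simp [mul_apply, Fin.sum_univ_add]
  exact ⟨_, h, fun k ↦ by rw [h, hdiag]⟩

/-! ### Convexity of the set of correlation matrices with uniform margins -/

/-- With mean `1/2` and variance `1/12`, correlation is `12 (E[XY] - 1/4)`, affine in the joint law.
-/
lemma mem_uniformCorrelationMatrices_of_integral {Ω : Type} [MeasurableSpace Ω] {P : Measure Ω}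
    [IsProbabilityMeasure P] {d : ℕ} {X : Fin d → Ω → ℝ} (hX : ∀ i, Measurable (X i))
    (hlaw : ∀ i, HasLaw (X i) stdUniform P) {R : Matrix (Fin d) (Fin d) ℝ}
    (hR : ∀ i j, R i j = 12 * ∫ ω, X i ω * X j ω ∂P - 3) : R ∈ uniformCorrelationMatrices d := by
  refine ⟨Ω, _, P, X, inferInstance, hX, hlaw, ?_⟩
  ext i j
  have hV (i) := (hlaw i).variance_eq.trans variance_id_stdUniform
  have hm (i) : ∫ ω, X i ω ∂P = 1 / 2 := (hlaw i).integral_eq.trans integral_id_stdUniform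
  have hmem (i) : MemLp (X i) 2 P := by
    have h := (hlaw i).map_eq ▸ memLp_id_stdUniform
    exact (memLp_map_measure_iff h.aestronglyMeasurable (hX i).aemeasurable).1 h
  rw [pearsonMatrix, Matrix.of_apply, pearson_eq_div (hV i) (hV j),
    covariance_eq_sub (hmem i) (hmem j), hm, hm, hR]
  simp only [Pi.mul_apply]
  ring

/-- Passing to joint laws on `ℝ^d` puts all witnesses on one space, where they can be mixed. -/
lemma exists_measure_of_mem_uniformCorrelationMatrices {d : ℕ} {R : Matrix (Fin d) (Fin d) ℝ}
    (hR : R ∈ uniformCorrelationMatrices d) :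
    ∃ μ : Measure (Fin d → ℝ), IsProbabilityMeasure μ ∧
      (∀ i, HasLaw (fun x : Fin d → ℝ ↦ x i) stdUniform μ) ∧
      (∀ i j, Integrable (fun x : Fin d → ℝ ↦ x i * x j) μ) ∧
      ∀ i j, R i j = 12 * ∫ x, x i * x j ∂μ - 3 := by
  obtain ⟨Ω, _, P, X, hP, hX, hlaw, rfl⟩ := hR
  have hXm : Measurable fun ω i ↦ X i ω := measurable_pi_lambda _ hX
  have hlaw' (i) : HasLaw (fun x : Fin d → ℝ ↦ x i) stdUniform (P.map fun ω i ↦ X i ω) :=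
    ⟨(measurable_pi_apply i).aemeasurable, by
      rw [Measure.map_map (measurable_pi_apply i) hXm, ← (hlaw i).map_eq]; rfl⟩
  have := Measure.isProbabilityMeasure_map (μ := P) hXm.aemeasurable
  have hV (i) := (hlaw i).variance_eq.trans variance_id_stdUniform
  have hm (i) : ∫ ω, X i ω ∂P = 1 / 2 := (hlaw i).integral_eq.trans integral_id_stdUniform
  have hmem (i) : MemLp (X i) 2 P := by
    have h := (hlaw i).map_eq ▸ memLp_id_stdUniform
    exact (memLp_map_measure_iff h.aestronglyMeasurable (hX i).aemeasurable).1 h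
  refine ⟨_, this, hlaw', fun i j ↦ ?_, fun i j ↦ ?_⟩
  · rw [integrable_map_measure (by fun_prop) hXm.aemeasurable]
    exact (hmem i).integrable_mul (hmem j)
  · rw [integral_map hXm.aemeasurable (by fun_prop), pearsonMatrix, Matrix.of_apply,
      pearson_eq_div (hV i) (hV j), covariance_eq_sub (hmem i) (hmem j), hm, hm]
    simp only [Pi.mul_apply]
    ring

theorem convex_uniformCorrelationMatrices (d : ℕ) : Convex ℝ (uniformCorrelationMatrices d) := by
  intro R hR R' hR' a b ha hb hab
  obtain ⟨μ, hμ, hlaw, hint, hR⟩ := exists_measure_of_mem_uniformCorrelationMatrices hR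
  obtain ⟨μ', hμ', hlaw', hint', hR'⟩ := exists_measure_of_mem_uniformCorrelationMatrices hR'
  have hab' : ENNReal.ofReal a + ENNReal.ofReal b = 1 := by
    rw [← ENNReal.ofReal_add ha hb, hab, ENNReal.ofReal_one]
  have : IsProbabilityMeasure (ENNReal.ofReal a • μ + ENNReal.ofReal b • μ') :=
    ⟨by simp [hab']⟩
  refine mem_uniformCorrelationMatrices_of_integral
    (P := ENNReal.ofReal a • μ + ENNReal.ofReal b • μ') (X := fun i x ↦ x i)
    (fun i ↦ measurable_pi_apply i) (fun i ↦ ⟨(measurable_pi_apply i).aemeasurable, ?_⟩) fun i j ↦ ?_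
  · rw [Measure.map_add _ _ (measurable_pi_apply i), Measure.map_smul, Measure.map_smul,
      (hlaw i).map_eq, (hlaw' i).map_eq, ← add_smul, hab', one_smul]
  · rw [integral_add_measure ((hint i j).smul_measure ENNReal.ofReal_ne_top)
      ((hint' i j).smul_measure ENNReal.ofReal_ne_top), integral_smul_measure,
      integral_smul_measure, ENNReal.toReal_ofReal ha, ENNReal.toReal_ofReal hb, Matrix.add_apply,
      Matrix.smul_apply, Matrix.smul_apply, hR, hR', smul_eq_mul, smul_eq_mul, smul_eq_mul,
      smul_eq_mul]
    linear_combination (-3 : ℝ) * hab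

/-! ### Archimedes' hat-box theorem via Gaussian vectors -/

open Real in
lemma gaussianPDFReal_zero_one (x : ℝ) : gaussianPDFReal 0 1 x =
    (√(2 * π))⁻¹ * exp (-x ^ 2 / 2) := by
  simp [gaussianPDFReal]

lemma measureReal_prod_eq_integral {α β : Type*} [MeasurableSpace α] [MeasurableSpace β]
    (μ : Measure α) (ν : Measure β) [IsProbabilityMeasure μ] [IsProbabilityMeasure ν]
    {s : Set (α × β)} (hs : MeasurableSet s) :
    (μ.prod ν).real s = ∫ x, ν.real (Prod.mk x ⁻¹' s) ∂μ := by
  rw [measureReal_def, Measure.prod_apply hs, integral_eq_lintegral_of_nonneg_ae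
    (.of_forall fun _ ↦ measureReal_nonneg)
    (measurable_measure_prodMk_left hs).ennreal_toReal.aestronglyMeasurable]
  simp

lemma integral_prod_stdNormal (f : ℝ × ℝ → ℝ) :
    ∫ p, f p ∂(stdNormal.prod stdNormal)
      = ∫ p : ℝ × ℝ, gaussianPDFReal 0 1 p.1 * gaussianPDFReal 0 1 p.2 * f p := by
  have hprod : stdNormal.prod stdNormal = (volume : Measure (ℝ × ℝ)).withDensity
      fun p ↦ gaussianPDF 0 1 p.1 * gaussianPDF 0 1 p.2 := by
    rw [stdNormal, gaussianReal_of_var_ne_zero _ one_ne_zero, prod_withDensity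
      (measurable_gaussianPDF _ _) (measurable_gaussianPDF _ _)]
    rfl
  rw [hprod, integral_withDensity_eq_integral_toReal_smul (by fun_prop)
    (.of_forall fun p ↦ ENNReal.mul_lt_top gaussianPDF_lt_top gaussianPDF_lt_top)]
  simp [toReal_gaussianPDF]

open Real in
/-- The radius of a planar standard normal vector has a Rayleigh distribution. -/
lemma stdNormal_prod_real_closedDisc {c : ℝ} (hc : 0 ≤ c) :
    (stdNormal.prod stdNormal).real {p | p.1 ^ 2 + p.2 ^ 2 ≤ c} = 1 - exp (-c / 2) := by
  have hs : MeasurableSet {p : ℝ × ℝ | p.1 ^ 2 + p.2 ^ 2 ≤ c} :=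
    measurableSet_le (by fun_prop) (by fun_prop)
  rw [← integral_indicator_one hs, integral_prod_stdNormal, ← integral_comp_polarCoord_symm, polarCoord_target]
  -- In polar coordinates the integrand, Jacobian included, is a radial function times the constant
  -- `(2π)⁻¹`.
  have h1 : ∀ p ∈ Set.Ioi (0 : ℝ) ×ˢ Set.Ioo (-π) π,
      p.1 • (gaussianPDFReal 0 1 (polarCoord.symm p).1 * gaussianPDFReal 0 1 (polarCoord.symm p).2 *
        {p : ℝ × ℝ | p.1 ^ 2 + p.2 ^ 2 ≤ c}.indicator 1 (polarCoord.symm p))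
      = (Set.Iic √c).indicator (fun r ↦ r * exp (-r ^ 2 / 2)) p.1 * (2 * π)⁻¹ := by
    rintro ⟨r, θ⟩ ⟨hr, -⟩
    have hr : 0 < r := hr
    have hsq : (r * cos θ) ^ 2 + (r * sin θ) ^ 2 = r ^ 2 := by
      linear_combination r ^ 2 * cos_sq_add_sin_sq θ
    have hiff : r ^ 2 ≤ c ↔ r ≤ √c := (Real.le_sqrt hr.le hc).symm
    simp only [polarCoord_symm_apply, Set.indicator_apply, Set.mem_ofPred_eq, hsq, hiff,
      Set.mem_Iic, gaussianPDFReal_zero_one, Pi.one_apply, smul_eq_mul]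
    split_ifs
    · rw [← hsq, neg_add, add_div, exp_add]
      have : (√(2 * π))⁻¹ * (√(2 * π))⁻¹ = (2 * π)⁻¹ := by
        rw [← mul_inv, mul_self_sqrt (by positivity)]
      linear_combination (r * exp (-(r * cos θ) ^ 2 / 2) * exp (-(r * sin θ) ^ 2 / 2)) * this
    · simp
  rw [setIntegral_congr_fun (measurableSet_Ioi.prod measurableSet_Ioo) h1, Measure.volume_eq_prod,
    setIntegral_prod_mul _ (fun _ ↦ (2 * π)⁻¹), setIntegral_indicator measurableSet_Iic,
    Set.Ioi_inter_Iic, ← intervalIntegral.integral_of_le (sqrt_nonneg c)]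
  have hderiv (x : ℝ) : HasDerivAt (fun r ↦ -exp (-r ^ 2 / 2)) (x * exp (-x ^ 2 / 2)) x := by
    convert! (((hasDerivAt_pow 2 x).neg.div_const 2).exp).neg using 1
    simp
    ring
  rw [intervalIntegral.integral_eq_sub_of_hasDerivAt (fun x _ ↦ hderiv x)
    (Continuous.intervalIntegrable (by fun_prop) _ _)]
  simp [Real.sq_sqrt hc, pi_pos.le]
  field_simp
  ring

/-- Shows that the section of the cone at height `x` is a disc, `q` being the squared distance from
the axis. -/
lemma mul_sqrt_sq_add_le_iff {t x q : ℝ} (ht : 0 < t) (hx : 0 ≤ x) :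
    t * √(x ^ 2 + q) ≤ x ↔ q ≤ x ^ 2 * (1 / t ^ 2 - 1) := by
  rw [← le_div_iff₀' ht, Real.sqrt_le_left (by positivity), ← le_sub_iff_add_le', div_pow,
    mul_sub, mul_one_div, mul_one]

open Real in
-- The integrand is `t` times the density of `N(0, t²)`.
lemma integral_Ioi_gaussian_scaled {t : ℝ} (ht : 0 < t) :
    ∫ x in Set.Ioi (0 : ℝ), (√(2 * π))⁻¹ * exp (-(1 / (2 * t ^ 2)) * x ^ 2) = t / 2 := by
  rw [integral_const_mul, integral_gaussian_Ioi,
    show π / (1 / (2 * t ^ 2)) = t ^ 2 * (2 * π) by field_simp,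
    sqrt_mul (sq_nonneg t) (2 * π), sqrt_sq ht.le]
  have : √(2 * π) ≠ 0 := by positivity
  field_simp

open Real in
/-- Archimedes' hat-box theorem for the first coordinate, in the upper half space. -/
lemma stdNormal_prod_real_cone {t : ℝ} (h0 : 0 < t) (h1 : t < 1) :
    (stdNormal.prod (stdNormal.prod stdNormal)).real
      {p | t * √(p.1 ^ 2 + (p.2.1 ^ 2 + p.2.2 ^ 2)) ≤ p.1} = (1 - t) / 2 := by
  have hs : MeasurableSet {p : ℝ × ℝ × ℝ | t * √(p.1 ^ 2 + (p.2.1 ^ 2 + p.2.2 ^ 2)) ≤ p.1} :=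
    measurableSet_le (by fun_prop) (by fun_prop)
  have hb : 0 < 1 / t ^ 2 - 1 := by
    rw [sub_pos, lt_div_iff₀ (by positivity)]; nlinarith
  have hsection (x : ℝ) : (stdNormal.prod stdNormal).real
      (Prod.mk x ⁻¹' {p : ℝ × ℝ × ℝ | t * √(p.1 ^ 2 + (p.2.1 ^ 2 + p.2.2 ^ 2)) ≤ p.1})
      = (Set.Ici 0).indicator (fun x ↦ 1 - exp (-(x ^ 2 * (1 / t ^ 2 - 1)) / 2)) x := by
    rcases lt_or_ge x 0 with hx | hx
    · rw [Set.indicator_of_notMem (by simpa using hx),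
        show Prod.mk x ⁻¹' {p : ℝ × ℝ × ℝ | t * √(p.1 ^ 2 + (p.2.1 ^ 2 + p.2.2 ^ 2)) ≤ p.1} = ∅ from
          Set.eq_empty_of_forall_notMem fun p hp ↦
            hx.not_ge ((mul_nonneg h0.le (sqrt_nonneg _)).trans hp), measureReal_empty]
    · rw [Set.indicator_of_mem (by simpa using hx),
        ← stdNormal_prod_real_closedDisc (by positivity)]
      congr 1
      ext p
      exact mul_sqrt_sq_add_le_iff h0 hx
  rw [measureReal_prod_eq_integral _ _ hs]
  simp only [hsection]
  rw [stdNormal, integral_gaussianReal_eq_integral_smul one_ne_zero]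
  -- The Rayleigh tail times the normal density is again Gaussian, of variance `t²`; the two terms
  -- integrate to `1/2` and `t/2`.
  have hpt (x : ℝ) : gaussianPDFReal 0 1 x •
      (Set.Ici 0).indicator (fun x ↦ 1 - exp (-(x ^ 2 * (1 / t ^ 2 - 1)) / 2)) x
      = (Set.Ici 0).indicator (fun x ↦ (√(2 * π))⁻¹ * exp (-(1 / (2 * 1 ^ 2)) * x ^ 2)
        - (√(2 * π))⁻¹ * exp (-(1 / (2 * t ^ 2)) * x ^ 2)) x := by
    by_cases hx : x ∈ Set.Ici (0 : ℝ)
    · rw [Set.indicator_of_mem hx, Set.indicator_of_mem hx, gaussianPDFReal_zero_one, smul_eq_mul,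
        mul_sub, mul_one, mul_assoc, ← exp_add]
      congr 3
      · ring_nf
      · field_simp
        ring
    · simp [Set.indicator_of_notMem hx]
  simp only [hpt]
  have hint {s : ℝ} (hs : 0 < s) : IntegrableOn
      (fun x : ℝ ↦ (√(2 * π))⁻¹ * exp (-(1 / (2 * s ^ 2)) * x ^ 2)) (Set.Ioi 0) :=
    ((integrable_exp_neg_mul_sq (by positivity)).const_mul _).integrableOn
  rw [integral_indicator measurableSet_Ici, integral_Ici_eq_integral_Ioi,
    integral_sub (hint one_pos) (hint h0), integral_Ioi_gaussian_scaled one_pos,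
    integral_Ioi_gaussian_scaled h0]
  ring

open Real in
lemma stdNormal_real_Ici_zero : stdNormal.real (Set.Ici 0) = 1 / 2 := by
  rw [← integral_indicator_one measurableSet_Ici, stdNormal,
    integral_gaussianReal_eq_integral_smul one_ne_zero, ← integral_Ioi_gaussian_scaled one_pos,
    ← integral_Ici_eq_integral_Ioi, ← integral_indicator measurableSet_Ici]
  congr with x
  by_cases hx : x ∈ Set.Ici (0 : ℝ)
  · rw [Set.indicator_of_mem hx, Set.indicator_of_mem hx, gaussianPDFReal_zero_one]
    simp only [Pi.one_apply, smul_eq_mul]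
    ring_nf
  · simp [Set.indicator_of_notMem hx]

/-- Coordinates in any orthonormal basis are independent standard normals, so `w` may be taken as
first basis vector. For `t = 0` the cone is a half-space, treated apart because of the `1 / t ^ 2`
above. -/
lemma stdGaussian_real_cone {w : EuclideanSpace ℝ (Fin 3)} (hw : ‖w‖ = 1) {t : ℝ} (h0 : 0 ≤ t)
    (h1 : t < 1) :
    (stdGaussian (EuclideanSpace ℝ (Fin 3))).real {x | t * ‖x‖ ≤ inner ℝ w x} = (1 - t) / 2 := by
  have hcone : (stdNormal.prod (stdNormal.prod stdNormal)).real
      {p | t * √(p.1 ^ 2 + (p.2.1 ^ 2 + p.2.2 ^ 2)) ≤ p.1} = (1 - t) / 2 := by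
    rcases h0.eq_or_lt with rfl | h0
    · rw [show {p : ℝ × ℝ × ℝ | 0 * √(p.1 ^ 2 + (p.2.1 ^ 2 + p.2.2 ^ 2)) ≤ p.1}
        = Set.Ici 0 ×ˢ Set.univ by ext; simp, measureReal_prod_prod, stdNormal_real_Ici_zero]
      simp
    · exact stdNormal_prod_real_cone h0 h1
  have horth : Orthonormal ℝ (Set.domRestrict {(0 : Fin 3)} fun _ ↦ w) :=
    ⟨fun _ ↦ hw, fun i j hij ↦ absurd (Subsingleton.elim i j) hij⟩
  obtain ⟨b, hb⟩ := horth.exists_orthonormalBasis_extension_of_card_eq (by simp)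
  have hb0 : b 0 = w := hb 0 rfl
  have hmp : MeasurePreserving
      (Prod.map id MeasurableEquiv.finTwoArrow ∘ MeasurableEquiv.piFinSuccAbove (fun _ ↦ ℝ) 0)
      (Measure.pi fun _ : Fin 3 ↦ gaussianReal 0 1)
      (stdNormal.prod (stdNormal.prod stdNormal)) :=
    ((MeasurePreserving.id stdNormal).prod (measurePreserving_finTwoArrow stdNormal)).comp
      (measurePreserving_piFinSuccAbove (fun _ : Fin 3 ↦ stdNormal) 0)
  rw [← hcone, measureReal_def, measureReal_def, stdGaussian_eq_map_pi_orthonormalBasis b,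
    Measure.map_apply (by fun_prop) (measurableSet_le (by fun_prop) (by fun_prop)),
    ← hmp.measure_preimage (measurableSet_le (by fun_prop) (by fun_prop)).nullMeasurableSet]
  congr 2
  ext x
  have hnorm : ‖∑ i, x i • b i‖ = √(x 0 ^ 2 + (x 1 ^ 2 + x 2 ^ 2)) := by
    rw [show ∑ i, x i • b i = b.repr.symm (WithLp.toLp 2 x) from b.sum_repr_symm (WithLp.toLp 2 x),
      LinearIsometryEquiv.norm_map, EuclideanSpace.norm_eq]
    simp [Fin.sum_univ_three, add_assoc]
  have hinner : inner ℝ w (∑ i, x i • b i) = x 0 := by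
    rw [← hb0, b.orthonormal.inner_right_fintype]
  simp only [Set.mem_preimage, Set.mem_ofPred_eq, hnorm, hinner]
  rfl

/-- The origin lies in every cone, and the mass `(1 - t) / 2` tends to `0` as `t → 1`. -/
lemma ae_stdGaussian_ne_zero : ∀ᵐ x ∂(stdGaussian (EuclideanSpace ℝ (Fin 3))), x ≠ 0 := by
  rw [ae_iff]
  simp only [ne_eq, not_not, Set.ofPred_eq_eq_singleton]
  rw [← measureReal_eq_zero_iff]
  refine le_antisymm (le_of_forall_gt_imp_ge_of_dense fun a ha ↦ ?_) measureReal_nonneg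
  obtain ⟨w, hw⟩ : ∃ w : EuclideanSpace ℝ (Fin 3), ‖w‖ = 1 := exists_norm_eq _ zero_le_one
  rcases lt_or_ge a (1 / 2) with h | h
  · have := stdGaussian_real_cone hw (t := 1 - 2 * a) (by linarith) (by linarith)
    rw [show a = (1 - (1 - 2 * a)) / 2 by ring, ← this]
    exact measureReal_mono (by simp)
  · refine le_trans ?_ (((stdGaussian_real_cone hw le_rfl one_pos).trans (by norm_num)).le.trans h)
    exact measureReal_mono (by simp)

/-- A criterion for a random variable to be uniformly distributed on `[0, 1]`. -/
lemma hasLaw_stdUniform_of_forall {Ω : Type*} [MeasurableSpace Ω] {P : Measure Ω}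
    [IsProbabilityMeasure P] {X : Ω → ℝ} (hX : Measurable X)
    (hlt : ∀ y ∈ Set.Ioo (0 : ℝ) 1, P.real {ω | X ω < y} ≤ y)
    (hle : ∀ y ∈ Set.Ioo (0 : ℝ) 1, y ≤ P.real {ω | X ω ≤ y}) : HasLaw X stdUniform P where
  map_eq := by
    have := Measure.isProbabilityMeasure_map (μ := P) hX.aemeasurable
    refine Measure.eq_of_cdf _ _ ?_
    ext x
    rw [cdf_eq_real, map_measureReal_apply hX measurableSet_Iic, cdf_stdUniform]
    refine le_antisymm (le_of_forall_gt_imp_ge_of_dense fun y hy ↦ ?_) ?_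
    · have hy0 : 0 < y := (le_max_left _ _).trans_lt hy
      rcases le_or_gt 1 y with hy1 | hy1
      · exact measureReal_le_one.trans hy1
      have hxy : x < y := by
        rcases min_lt_iff.1 ((le_max_right _ _).trans_lt hy) with h | h
        · exact h
        · exact absurd h hy1.not_gt
      exact le_trans (measureReal_mono fun ω (hω : X ω ≤ x) ↦ hω.trans_lt hxy) (hlt y ⟨hy0, hy1⟩)
    · refine max_le measureReal_nonneg (le_of_forall_lt_imp_le_of_dense fun y hy ↦ ?_)
      rcases le_or_gt y 0 with hy0 | hy0
      · exact hy0.trans measureReal_nonneg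
      obtain ⟨hyx, hy1⟩ := lt_min_iff.1 hy
      exact (hle y ⟨hy0, hy1⟩).trans
        (measureReal_mono fun ω (hω : X ω ≤ y) ↦ hω.trans hyx.le)

/-- **Archimedes' hat-box theorem**: the projections of a uniformly distributed point of the unit
sphere in `ℝ^3` to lines through the origin are uniformly distributed. -/
theorem hasLaw_inner_div_norm {w : EuclideanSpace ℝ (Fin 3)} (hw : ‖w‖ = 1) :
    HasLaw (fun x ↦ (1 + inner ℝ w x / ‖x‖) / 2) stdUniform
      (stdGaussian (EuclideanSpace ℝ (Fin 3))) := by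
  set γ := stdGaussian (EuclideanSpace ℝ (Fin 3))
  have htail {v : EuclideanSpace ℝ (Fin 3)} (hv : ‖v‖ = 1) {t : ℝ} (h0 : 0 ≤ t) (h1 : t < 1) :
      γ.real {x | t ≤ inner ℝ v x / ‖x‖} = (1 - t) / 2 := by
    rw [← stdGaussian_real_cone hv h0 h1]
    refine measureReal_congr ?_
    filter_upwards [ae_stdGaussian_ne_zero] with x hx
    exact propext (le_div_iff₀ (norm_pos_iff.2 hx))
  have hm : Measurable fun x : EuclideanSpace ℝ (Fin 3) ↦ (1 + inner ℝ w x / ‖x‖) / 2 := by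
    fun_prop
  -- The cone formula needs `t ≥ 0`: values `y ≤ 1/2` come from the cone around `-w`, larger ones
  -- from the complement of the cone around `w`, whence the strict inequality there.
  have hlow {y : ℝ} (h0 : 0 < y) (h1 : y ≤ 1 / 2) :
      γ.real {x | (1 + inner ℝ w x / ‖x‖) / 2 ≤ y} = y := by
    have h := htail (v := -w) (by rwa [norm_neg]) (t := 1 - 2 * y) (by linarith) (by linarith)
    rw [show (1 - (1 - 2 * y)) / 2 = y by ring] at h
    refine Eq.trans ?_ h
    congr 1
    ext x
    simp only [Set.mem_ofPred_eq, inner_neg_left, neg_div]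
    constructor <;> intro <;> linarith
  have hhigh {y : ℝ} (h0 : 1 / 2 < y) (h1 : y < 1) :
      γ.real {x | (1 + inner ℝ w x / ‖x‖) / 2 < y} = y := by
    have h := htail hw (t := 2 * y - 1) (by linarith) (by linarith)
    have hc : {x | (1 + inner ℝ w x / ‖x‖) / 2 < y} = {x | 2 * y - 1 ≤ inner ℝ w x / ‖x‖}ᶜ := by
      ext x
      simp only [Set.mem_ofPred_eq, Set.mem_compl_iff, not_le]
      constructor <;> intro <;> linarith
    rw [hc, probReal_compl_eq_one_sub (measurableSet_le (by fun_prop) (by fun_prop)), h]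
    ring
  refine hasLaw_stdUniform_of_forall hm (fun y hy ↦ ?_) fun y hy ↦ ?_
  · rcases le_or_gt y (1 / 2) with h | h
    · exact (measureReal_mono fun x (hx : _ < y) ↦ hx.le).trans (hlow hy.1 h).le
    · exact (hhigh h hy.2).le
  · rcases le_or_gt y (1 / 2) with h | h
    · exact (hlow hy.1 h).ge
    · exact (hhigh h hy.2).ge.trans (measureReal_mono fun x (hx : _ < y) ↦ hx.le)

/-! ### Covariances of spherical projections, and the case `d ≤ 9` -/

lemma integrable_inner_div_norm_mul (v w : EuclideanSpace ℝ (Fin 3)) :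
    Integrable (fun x ↦ inner ℝ v x / ‖x‖ * (inner ℝ w x / ‖x‖))
      (stdGaussian (EuclideanSpace ℝ (Fin 3))) := by
  have h (v x : EuclideanSpace ℝ (Fin 3)) : |inner ℝ v x / ‖x‖| ≤ ‖v‖ := by
    rw [abs_div, abs_norm]
    exact div_le_of_le_mul₀ (norm_nonneg _) (norm_nonneg _) (abs_real_inner_le_norm v x)
  refine .of_bound (by fun_prop) (‖v‖ * ‖w‖) (.of_forall fun x ↦ ?_)
  rw [Real.norm_eq_abs, abs_mul]
  exact mul_le_mul (h v x) (h w x) (abs_nonneg _) (norm_nonneg _)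

/-- After normalising `w`, this is `E[(2U - 1)²] = 1/3` for uniform `U`. -/
lemma integral_inner_div_norm_sq (w : EuclideanSpace ℝ (Fin 3)) :
    ∫ x, (inner ℝ w x / ‖x‖) ^ 2 ∂(stdGaussian (EuclideanSpace ℝ (Fin 3))) = ‖w‖ ^ 2 / 3 := by
  rcases eq_or_ne w 0 with rfl | hw
  · simp
  have hw0 : ‖w‖ ≠ 0 := norm_ne_zero_iff.2 hw
  have hlaw := hasLaw_inner_div_norm (w := ‖w‖⁻¹ • w) (by
    rw [norm_smul, norm_inv, norm_norm, inv_mul_cancel₀ hw0])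
  have h := hlaw.integral_comp (f := fun p ↦ ‖w‖ ^ 2 * (2 * p - 1) ^ 2)
    (Measurable.aestronglyMeasurable (by fun_prop))
  rw [integral_stdUniform, intervalIntegral.integral_const_mul,
    show ∫ x in (0 : ℝ)..1, (2 * x - 1) ^ 2 = 1 / 3 by
      rw [intervalIntegral.integral_comp_mul_sub (fun x ↦ x ^ 2) two_ne_zero]
      norm_num [integral_pow]] at h
  rw [div_eq_mul_one_div (‖w‖ ^ 2), ← h]
  refine integral_congr_ae (.of_forall fun x ↦ ?_)
  simp only [Function.comp_apply, inner_smul_left, RCLike.conj_to_real]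
  field_simp
  ring

/-- Polarisation of the second moment. -/
lemma integral_inner_div_norm_mul (v w : EuclideanSpace ℝ (Fin 3)) :
    ∫ x, inner ℝ v x / ‖x‖ * (inner ℝ w x / ‖x‖) ∂(stdGaussian (EuclideanSpace ℝ (Fin 3)))
      = inner ℝ v w / 3 := by
  have h1 := integral_inner_div_norm_sq (v + w)
  have h2 := integral_inner_div_norm_sq (v - w)
  have hsq (u : EuclideanSpace ℝ (Fin 3)) : Integrable (fun x ↦ (inner ℝ u x / ‖x‖) ^ 2)
      (stdGaussian (EuclideanSpace ℝ (Fin 3))) := by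
    simpa only [sq] using integrable_inner_div_norm_mul u u
  have h3 : ∫ x, (4 * (inner ℝ v x / ‖x‖ * (inner ℝ w x / ‖x‖)))
      ∂(stdGaussian (EuclideanSpace ℝ (Fin 3))) = ‖v + w‖ ^ 2 / 3 - ‖v - w‖ ^ 2 / 3 := by
    rw [← h1, ← h2, ← integral_sub (hsq _) (hsq _)]
    refine integral_congr_ae (.of_forall fun x ↦ ?_)
    simp only [inner_add_left, inner_sub_left]
    ring
  rw [integral_const_mul, norm_add_sq_real, norm_sub_sq_real] at h3
  linarith

open Matrix in
/-- Gram matrices of unit vectors in `ℝ^3` are correlation matrices with uniform margins. -/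
theorem gram_fin_three_mem_uniformCorrelationMatrices {d : ℕ} (W : Matrix (Fin 3) (Fin d) ℝ)
    (hW : ∀ k, (Wᵀ * W) k k = 1) : Wᵀ * W ∈ uniformCorrelationMatrices d := by
  let w (k : Fin d) : EuclideanSpace ℝ (Fin 3) := WithLp.toLp 2 fun i ↦ W i k
  have hinner (k l) : inner ℝ (w k) (w l) = (Wᵀ * W) k l := by
    simp [w, PiLp.inner_apply, mul_apply, mul_comm]
  have hnorm (k) : ‖w k‖ = 1 := by
    have h := real_inner_self_eq_norm_sq (w k)
    rw [hinner, hW] at h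
    exact (pow_eq_one_iff_of_nonneg (norm_nonneg _) two_ne_zero).1 h.symm
  have hlaw (k) := hasLaw_inner_div_norm (hnorm k)
  refine mem_uniformCorrelationMatrices_of_integral
    (P := stdGaussian (EuclideanSpace ℝ (Fin 3)))
    (X := fun k x ↦ (1 + inner ℝ (w k) x / ‖x‖) / 2) (fun k ↦ by fun_prop) hlaw fun k l ↦ ?_
  have hint (k) : Integrable (fun x ↦ (1 + inner ℝ (w k) x / ‖x‖) / 2)
      (stdGaussian (EuclideanSpace ℝ (Fin 3))) := by
    have h := (hlaw k).map_eq ▸ memLp_id_stdUniform.integrable one_le_two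
    exact (integrable_map_measure h.aestronglyMeasurable (hlaw k).aemeasurable).1 h
  have hm (k) := (hlaw k).integral_eq.trans integral_id_stdUniform
  -- Expanded so that only known integrals remain: the expectation is `⟨w k, w l⟩ / 12 + 1/4`.
  have h (x : EuclideanSpace ℝ (Fin 3)) : (1 + inner ℝ (w k) x / ‖x‖) / 2 *
      ((1 + inner ℝ (w l) x / ‖x‖) / 2)
      = 1 / 4 * (inner ℝ (w k) x / ‖x‖ * (inner ℝ (w l) x / ‖x‖))
        + (1 / 2 * ((1 + inner ℝ (w k) x / ‖x‖) / 2)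
        + (1 / 2 * ((1 + inner ℝ (w l) x / ‖x‖) / 2) - 1 / 4)) := by ring
  simp only [h]
  have hk := (hint k).const_mul (1 / 2)
  have hl := (hint l).const_mul (1 / 2)
  have hl' : Integrable (fun x ↦ 1 / 2 * ((1 + inner ℝ (w l) x / ‖x‖) / 2) - 1 / 4)
      (stdGaussian (EuclideanSpace ℝ (Fin 3))) := hl.sub (integrable_const _)
  have hkl : Integrable (fun x ↦ 1 / 2 * ((1 + inner ℝ (w k) x / ‖x‖) / 2) +
      (1 / 2 * ((1 + inner ℝ (w l) x / ‖x‖) / 2) - 1 / 4))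
      (stdGaussian (EuclideanSpace ℝ (Fin 3))) := hk.add hl'
  rw [integral_add ((integrable_inner_div_norm_mul _ _).const_mul _) hkl, integral_add hk hl',
    integral_sub hl (integrable_const _), integral_const_mul, integral_const_mul,
    integral_const_mul, integral_inner_div_norm_mul, hm, hm, hinner, integral_const]
  simp
  ring

theorem correlationMatrices_subset_uniformCorrelationMatrices {d : ℕ} (hd : d ≤ 9) :
    correlationMatrices d ⊆ uniformCorrelationMatrices d := by
  intro R hR
  obtain ⟨W, rfl, hW⟩ := exists_gram_of_mem_correlationMatrices 3 hR
  refine gram_mem_of_convex (convex_uniformCorrelationMatrices d) ?_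
    gram_fin_three_mem_uniformCorrelationMatrices d W hW
  rw [Fintype.card_fin]
  -- Here `(3 + 2).choose 2 = 10`, the dimension of the space of quadratic forms on `ℝ^4`.
  exact Nat.lt_succ_of_le hd

theorem proposition3p4 (d : ℕ) :
    (d ≤ 9 → uniformCorrelationMatrices d = correlationMatrices d) ∧
    uniformCorrelationMatrices d ⊆ correlationMatrices d ∧
    spearmanMatrices d = uniformCorrelationMatrices d ∧
    blomqvistMatrices d = bernoulliCorrelationMatrices half d ∧
    vanDerWaerdenMatrices d = correlationMatrices d :=
  ⟨fun hd ↦ (uniformCorrelationMatrices_subset d).antisymm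
      (correlationMatrices_subset_uniformCorrelationMatrices hd),
    uniformCorrelationMatrices_subset d, spearmanMatrices_eq d, blomqvistMatrices_eq d,
    (vanDerWaerdenMatrices_eq d).trans (marginCorrelationMatrices_stdNormal d)⟩
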